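/- Let $p_1=2,p_2=3,\dots$ be the primes in increasing order, let $m_\infty$ be the normalized Haar measure on $\mathbb{T}^\infty$, and let $H^\infty(\mathbb{D}^\infty)$ be the space of all $F\in L^\infty(\mathbb{T}^\infty,m_\infty)$ whose Fourier coefficients $\widehat F(\beta)=\int_{\mathbb{T}^\infty}F(\tau)\overline{\tau^\beta}\,dm_\infty(\tau)$, for finitely supported integer multi-indices $\beta$, vanish whenever $\beta$ has at least one negative entry; the element $F$ of $L^\infty(\mathbb{T}^\infty)$ is called the boundary function. For $z\in\mathbb{D}^\infty\cap c_0$ (that is, $|z_j|<1$ for all $j$ and $z_j\to0$) put $F(z)=\lim_{n\to\infty}\sum_{\beta\in\mathbb{N}_0^n}\widehat F(\beta)z_1^{\beta_1}\cdots z_n^{\beta_n}$, where these series converge absolutely. For $\tau\in\mathbb{T}^\infty$ let $b_\theta(\tau)=(p_1^{-\theta}\tau_1,p_2^{-\theta}\tau_2,\dots)$ for $\theta>0$ and $T_t(\tau)=(p_1^{-it}\tau_1,p_2^{-it}\tau_2,\dots)$ for $t\in\mathbb{R}$. Let $F\in H^\infty(\mathbb{D}^\infty)$. Then the limit defining $F(z)$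 exists for every $z\in\mathbb{D}^\infty\cap c_0$, and there is a Borel measurable representative $\widetilde F:\mathbb{T}^\infty\to\mathbb{C}$ of the boundary function of $F$ such that $$\widetilde F(\tau)=\lim_{\theta\to0^+}F(b_\theta(\tau))$$ for $m_\infty$-almost every $\tau\in\mathbb{T}^\infty$ (in particular the limit exists for these $\tau$). In fact, for every $\tau\in\mathbb{T}^\infty$ the limit $\lim_{\theta\to0^+}F(b_\theta(\tau'))$ exists and equals $\widetilde F(\tau')$ for almost every point $\tau'=T_t(\tau)$ of the orbit $\{T_t(\tau):t\in\mathbb{R}\}$, that is, for Lebesgue-almost every $t\in\mathbb{R}$. -/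

import Mathlib

open MeasureTheory Filter Topology

noncomputable section

namespace InfPolydisc

/-- The unit circle carries its Borel σ-algebra. -/
instance instMeasurableSpaceCircle : MeasurableSpace Circle := borel Circle

instance instBorelSpaceCircle : BorelSpace Circle := ⟨rfl⟩

/-- The infinite-dimensional torus `𝕋^∞`, a compact abelian group under coordinatewise
multiplication; coordinates are indexed from `0`. -/
abbrev Torus : Type := ℕ → Circle

/-- The normalized Haar measure `m_∞` on `𝕋^∞`. -/
def haarTorus : Measure Torus := Measure.haarMeasure ⊤

instance instIsProbabilityMeasureHaarTorus : IsProbabilityMeasure haarTorus :=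
  ⟨by
    have h := Measure.haarMeasure_self (K₀ := (⊤ : TopologicalSpace.PositiveCompacts Torus))
    simpa [haarTorus] using h⟩

/-- The `j`-th prime, with `prime 0 = 2`, `prime 1 = 3`, and so on. -/
def prime (j : ℕ) : ℕ := Nat.nth Nat.Prime j

/-- The monomial `τ^β` on the torus, for an integer multi-index `β` with finite support. -/
def torusMonomial (β : ℕ →₀ ℤ) (τ : Torus) : ℂ := ((β.prod fun j k => τ j ^ k : Circle) : ℂ)

/-- The Fourier coefficient `∫ F(τ) conj(τ^β) dm_∞(τ)`. -/
def fourierCoefficient (F : Torus → ℂ) (β : ℕ →₀ ℤ) : ℂ :=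
  ∫ τ, F τ * (starRingEnd ℂ) (torusMonomial β τ) ∂haarTorus

/-- `H^∞(𝔻^∞)`: the analytic elements of `L^∞(𝕋^∞)`, i.e. those whose Fourier coefficients with
at least one negative index all vanish. -/
def HInfty : Set (Lp ℂ ⊤ haarTorus) :=
  {F | ∀ β : ℕ →₀ ℤ, (∃ j, β j < 0) → fourierCoefficient F β = 0}

/-- The open set `𝔻^∞ ∩ c₀` of the points at which functions in `H^∞(𝔻^∞)` have values. -/
def polydiscC0 : Set (ℕ → ℂ) :=
  {z | (∀ j, ‖z j‖ < 1) ∧ Tendsto z atTop (𝓝 0)}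

/-- The point `(z_1, …, z_n, 0, 0, …)`. -/
def truncate (n : ℕ) (z : ℕ → ℂ) : ℕ → ℂ := fun j => if j < n then z j else 0

/-- The term `b_β z^β` of the power series of `F`, where `b_β` is the Fourier coefficient of `F`
with index `β`. -/
def powerSeriesTerm (F : Torus → ℂ) (z : ℕ → ℂ) (β : ℕ →₀ ℕ) : ℂ :=
  fourierCoefficient F (β.mapRange (fun k : ℕ => (k : ℤ)) rfl) * β.prod fun j k => z j ^ k

/-- `w` is the value of `F` at `z`: the power series of `F` converges (unconditionally) at each
of the truncations `(z_1, …, z_n, 0, 0, …)`, and its sums tend to `w` as `n → ∞`. -/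
def HasValue (F : Torus → ℂ) (z : ℕ → ℂ) (w : ℂ) : Prop :=
  (∀ n, Summable (powerSeriesTerm F (truncate n z))) ∧
    Tendsto (fun n => ∑' β, powerSeriesTerm F (truncate n z) β) atTop (𝓝 w)

/-- The value `F(z)`. -/
def value (F : Torus → ℂ) (z : ℕ → ℂ) : ℂ :=
  limUnder atTop fun n => ∑' β, powerSeriesTerm F (truncate n z) β

/-- `b_θ(τ) = (p_1^{-θ} τ_1, p_2^{-θ} τ_2, …)`. -/
def b (θ : ℝ) (τ : Torus) : ℕ → ℂ := fun j => (((prime j : ℝ) ^ (-θ) : ℝ) : ℂ) * (τ j : ℂ)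

/-- The Kronecker flow `T_t(τ) = (p_1^{-it} τ_1, p_2^{-it} τ_2, …)` on `𝕋^∞`. -/
def flow (t : ℝ) (τ : Torus) : Torus := fun j => Circle.exp (-(t * Real.log (prime j))) * τ j

theorem flow_apply (t : ℝ) (τ : Torus) (j : ℕ) :
    (flow t τ j : ℂ) = (prime j : ℂ) ^ (-(Complex.I * t)) * (τ j : ℂ) := by
  have hp : (prime j : ℂ) ≠ 0 := by
    exact_mod_cast (Nat.prime_nth_prime j).ne_zero
  rw [flow, Circle.coe_mul, Circle.coe_exp, Complex.cpow_def_of_ne_zero hp]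
  congr 2
  rw [← Complex.natCast_log]
  push_cast
  ring

end InfPolydisc

end

open InfPolydisc

/-!
# Boundary values of bounded analytic functions on the infinite polydisc

*Values.* At a point with only `n` nonzero coordinates the power series of `F` is the integral of
`F` against a product of `n` Poisson kernels: the kernel expands into an absolutely convergent
Fourier series, and analyticity removes every term with a negative index
(`IsAnalyticBounded.hasSum_powerSeriesTerm`). Since the kernel is a probability density, the sums
are bounded by `‖F‖`. Switching on the coordinates from `m` to `n - 1` through one complex
parameter and applying the Schwarz lemma bounds the change of the value by a multiple of
`sup_{j ≥ m} ‖z j‖` (`IsAnalyticBounded.norm_partialValue_sub_le`), so that the values converge on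
`𝔻^∞ ∩ c₀`, uniformly in points with a common majorant in `c₀`.

*Limits on orbits.* For fixed `τ` the function `s ↦ F(p_j^{-s} τ_j)` is therefore bounded and
holomorphic on the right half-plane, and its value at `θ + it` is `F(b_θ(T_t τ))`. Fatou's theorem
(`ae_exists_tendsto_of_bounded_on_halfPlane`) gives the limit as `θ → 0+` for almost every `t`. It
is proved here through the primitive `G` of a bounded holomorphic function `g`: `G` is Lipschitz,
hence differentiable along almost every point of the imaginary axis, and a two-constants estimate
at such a point, followed by the Cauchy estimate, carries the derivative over to `g = G'`.

*The torus.* The set of convergence is measurable and contains almost every point of every orbit.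
The flow preserves the Haar measure, so Fubini's theorem shows that this set has full measure. The
limit function has the Fourier coefficients of `F`, by dominated convergence, and a bounded
function on the torus is determined by its Fourier coefficients, the trigonometric polynomials
being dense (`ae_eq_of_fourierCoefficient_eq`).
-/

noncomputable section

namespace InfPolydisc

/-! ### Fatou's theorem on the right half-plane -/

/-- A two-constants estimate near the origin. If `‖G w‖ ≤ L ‖w‖` on the half-plane and
`‖G w‖ ≤ ε ‖w‖` on a boundary segment around `0`, then the constant `ε` persists near `0`, up to a
factor tending to `1`. The maximum principle is applied to `G w / w` on a rectangle, with an
exponential factor that is at most `1` on the boundary segment and at most `ε / L` on the other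
three sides. -/
lemma exists_norm_le_mul_exp_of_norm_le_on_segment {G : ℂ → ℂ} {L ε δ : ℝ} (hGc : Continuous G)
    (hGd : DifferentiableOn ℂ G {w | 0 < w.re}) (hL : ∀ w, ‖G w‖ ≤ L * ‖w‖) (hε : 0 < ε)
    (hδ : 0 < δ) (h : ∀ y : ℝ, |y| ≤ δ → ‖G (y * Complex.I)‖ ≤ ε * |y|) :
    ∃ C, 0 ≤ C ∧ ∀ w : ℂ, 0 < w.re → w.re < δ / 2 → |w.im| < δ →
      ‖G w‖ ≤ ε * ‖w‖ * Real.exp (C * ‖w‖) := by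
  have hL0 : 0 ≤ L := by simpa using (norm_nonneg _).trans (hL 1)
  -- `Q` satisfies `L * exp (-Q) ≤ ε`
  set Q : ℝ := L / ε with hQ
  have hQ0 : 0 ≤ Q := by positivity
  have hLQ : L * Real.exp (-Q) ≤ ε := by
    have h1 : Q + 1 ≤ Real.exp Q := Real.add_one_le_exp Q
    have h2 : L = Q * ε := by rw [hQ]; field_simp
    rw [Real.exp_neg, ← div_eq_mul_inv, div_le_iff₀ (Real.exp_pos Q), h2, mul_comm]
    gcongr
    linarith
  -- `A` and `B` make the exponent at most `-Q` on the horizontal sides and the right side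
  set A : ℝ := 4 / (3 * δ ^ 2) * Q with hA
  set B : ℝ := 2 / δ * (A * (δ / 2) ^ 2 + Q) with hB
  have hA0 : 0 ≤ A := by positivity
  have hB0 : 0 ≤ B := by positivity
  have hexp : ∀ w : ℂ, ‖Complex.exp (A * w ^ 2 - B * w)‖ =
      Real.exp (A * (w.re ^ 2 - w.im ^ 2) - B * w.re) := by
    intro w
    rw [Complex.norm_exp]
    congr 1
    simp [pow_two]
  set U : Set ℂ := Set.Ioo 0 (δ / 2) ×ℂ Set.Ioo (-δ) δ with hU
  -- dividing by `w + κ` instead of `w` keeps the quotient continuous up to the origin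
  have key : ∀ κ : ℝ, 0 < κ → ∀ w ∈ U,
      ‖G w / (w + κ) * Complex.exp (A * w ^ 2 - B * w)‖ ≤ ε := by
    intro κ hκ w hw
    have hne : ∀ w : ℂ, 0 ≤ w.re → w + κ ≠ 0 := by
      intro w hw h0
      have := congrArg Complex.re h0
      simp at this
      linarith
    have hcl : closure U = Set.Icc 0 (δ / 2) ×ℂ Set.Icc (-δ) δ := by
      rw [hU, Complex.closure_reProdIm, closure_Ioo (by positivity), closure_Ioo (by linarith)]
    have hUo : IsOpen U := isOpen_Ioo.reProdIm isOpen_Ioo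
    have hb : Bornology.IsBounded U :=
      (Metric.isBounded_Ioo _ _).reProdIm (Metric.isBounded_Ioo _ _)
    have hquot : ∀ w : ℂ, 0 ≤ w.re → ‖w‖ ≤ ‖w + κ‖ := by
      intro w hw
      rw [Complex.norm_eq_sqrt_sq_add_sq, Complex.norm_eq_sqrt_sq_add_sq]
      apply Real.sqrt_le_sqrt
      simp
      nlinarith
    have hGL : ∀ w : ℂ, 0 ≤ w.re → ‖G w / (w + κ)‖ ≤ L := by
      intro w hw
      rw [norm_div, div_le_iff₀ (norm_pos_iff.2 (hne w hw))]
      exact (hL w).trans (mul_le_mul_of_nonneg_left (hquot w hw) hL0)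
    refine Complex.norm_le_of_forall_mem_frontier_norm_le hb
      (f := fun w : ℂ => G w / (w + κ) * Complex.exp (A * w ^ 2 - B * w)) ?_ ?_ (subset_closure hw)
    · refine ⟨?_, ?_⟩
      · refine DifferentiableOn.mul (DifferentiableOn.div ?_ (by fun_prop) ?_) (by fun_prop)
        · exact hGd.mono fun w hw => (Complex.mem_reProdIm.1 hw).1.1
        · exact fun w hw => hne w (Complex.mem_reProdIm.1 hw).1.1.le
      · refine ContinuousOn.mul (ContinuousOn.div hGc.continuousOn (by fun_prop) ?_) (by fun_prop)
        rw [hcl]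
        exact fun w hw => hne w (Complex.mem_reProdIm.1 hw).1.1
    · intro z hz
      rw [norm_mul, hexp]
      have hzc : z ∈ closure U := frontier_subset_closure hz
      rw [hcl, Complex.mem_reProdIm] at hzc
      obtain ⟨⟨hx0, hx1⟩, hy0, hy1⟩ := hzc
      have small : A * (z.re ^ 2 - z.im ^ 2) - B * z.re ≤ -Q →
          ‖G z / (z + κ)‖ * Real.exp (A * (z.re ^ 2 - z.im ^ 2) - B * z.re) ≤ ε := fun hs =>
        (mul_le_mul (hGL z hx0) (Real.exp_le_exp.2 hs) (Real.exp_pos _).le hL0).trans hLQ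
      rcases eq_or_lt_of_le hx0 with hx | hx
      · -- on the left side the exponential factor is at most `1`
        have hz' : z = z.im * Complex.I := by
          apply Complex.ext <;> simp [← hx]
        have h1 : ‖G z‖ ≤ ε * ‖z‖ := by
          have := h z.im (abs_le.2 ⟨hy0, hy1⟩)
          rw [← hz'] at this
          refine this.trans (mul_le_mul_of_nonneg_left (Complex.abs_im_le_norm z) hε.le)
        have h2 : ‖G z / (z + κ)‖ ≤ ε := by
          rw [norm_div, div_le_iff₀ (norm_pos_iff.2 (hne z hx0))]
          exact h1.trans (mul_le_mul_of_nonneg_left (hquot z hx0) hε.le)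
        have h3 : Real.exp (A * (z.re ^ 2 - z.im ^ 2) - B * z.re) ≤ 1 := by
          rw [Real.exp_le_one_iff, ← hx]
          have : 0 ≤ A * z.im ^ 2 := by positivity
          linarith
        calc _ ≤ ε * 1 := mul_le_mul h2 h3 (Real.exp_pos _).le hε.le
          _ = ε := mul_one _
      rcases eq_or_lt_of_le hx1 with hx' | hx'
      · -- on the right side the choice of `B` makes the exponent at most `-Q`
        apply small
        rw [hx']
        have : B * (δ / 2) = A * (δ / 2) ^ 2 + Q := by rw [hB]; field_simp
        rw [this]
        have : 0 ≤ A * z.im ^ 2 := by positivity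
        linarith
      · -- on the horizontal sides the choice of `A` does the same
        have him : z.im ^ 2 = δ ^ 2 := by
          rcases eq_or_lt_of_le hy0 with hy | hy
          · rw [← hy]; ring
          rcases eq_or_lt_of_le hy1 with hy' | hy'
          · rw [hy']
          · exact absurd (⟨⟨hx, hx'⟩, ⟨hy, hy'⟩⟩ : z ∈ U)
              (by rw [frontier, hUo.interior_eq] at hz; exact hz.2)
        apply small
        rw [him]
        have h1 : A * (3 / 4 * δ ^ 2) = Q := by rw [hA]; field_simp
        have h2 : A * z.re ^ 2 ≤ A * (δ / 2) ^ 2 := by gcongr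
        have h3 : 0 ≤ B * z.re := by positivity
        linarith
  refine ⟨A * δ + B, by positivity, fun w hw0 hw1 hw2 => ?_⟩
  have hwU : w ∈ U := ⟨⟨hw0, hw1⟩, abs_lt.1 hw2⟩
  set e : ℝ := Real.exp (A * (w.re ^ 2 - w.im ^ 2) - B * w.re) with he
  have hepos : 0 < e := Real.exp_pos _
  have h1 : ‖G w‖ * e ≤ ε * ‖w‖ := by
    refine le_of_forall_pos_le_add fun κ hκ => ?_
    have hκ' : 0 < κ / ε := by positivity
    have := key (κ / ε) hκ' w hwU
    rw [norm_mul, hexp, norm_div, ← he, div_mul_eq_mul_div, div_le_iff₀] at this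
    · refine this.trans ?_
      calc ε * ‖w + (κ / ε : ℝ)‖ ≤ ε * (‖w‖ + κ / ε) := by
            gcongr
            refine (norm_add_le _ _).trans ?_
            rw [Complex.norm_real, Real.norm_of_nonneg hκ'.le]
        _ = _ := by field_simp
    · rw [norm_pos_iff]
      intro h0
      have := congrArg Complex.re h0
      simp only [Complex.add_re, Complex.ofReal_re, Complex.zero_re] at this
      linarith
  have h2 : ‖G w‖ ≤ ε * ‖w‖ * e⁻¹ := by
    rwa [← div_eq_mul_inv, le_div_iff₀ hepos]
  refine h2.trans ?_
  gcongr
  rw [he, ← Real.exp_neg, Real.exp_le_exp]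
  have hre : w.re ≤ ‖w‖ := Complex.re_le_norm w
  have him : |w.im| ≤ ‖w‖ := Complex.abs_im_le_norm w
  have h3 : w.im ^ 2 ≤ δ * ‖w‖ := by
    rw [← sq_abs, pow_two]
    exact mul_le_mul hw2.le him (abs_nonneg _) hδ.le
  have h4 : A * w.im ^ 2 ≤ A * (δ * ‖w‖) := by gcongr
  have h5 : B * w.re ≤ B * ‖w‖ := by gcongr
  have h6 : 0 ≤ A * w.re ^ 2 := by positivity
  linarith

/-- **Fatou's theorem** on the right half-plane, for limits along horizontal lines: a bounded
holomorphic function has a limit at almost every point of the imaginary axis. -/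
theorem ae_exists_tendsto_of_bounded_on_halfPlane {g : ℂ → ℂ} {M : ℝ}
    (hg : DifferentiableOn ℂ g {s | 0 < s.re}) (hM : ∀ s : ℂ, 0 < s.re → ‖g s‖ ≤ M) :
    ∀ᵐ t : ℝ, ∃ l, Tendsto (fun θ : ℝ => g (θ + t * Complex.I)) (𝓝[>] 0) (𝓝 l) := by
  have hconv : Convex ℝ {s : ℂ | 0 < s.re} := convex_halfSpace_re_gt 0
  have hopen : IsOpen {s : ℂ | 0 < s.re} := isOpen_lt continuous_const Complex.continuous_re
  obtain ⟨G₀, hG₀⟩ := hconv.exists_forall_hasDerivWithinAt hg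
  have hlip₀ : LipschitzOnWith M.toNNReal G₀ {s | 0 < s.re} := by
    refine hconv.lipschitzOnWith_of_nnnorm_hasDerivWithin_le hG₀ fun s hs => ?_
    rw [← norm_toNNReal]
    exact Real.toNNReal_le_toNNReal (hM s hs)
  obtain ⟨G, hlip, hEq⟩ := hlip₀.extend_finite_dimension
  set K := lipschitzExtensionConstant ℂ * M.toNNReal
  have hG : ∀ s : ℂ, 0 < s.re → HasDerivAt G (g s) s := fun s hs =>
    ((hG₀ s hs).hasDerivAt (hopen.mem_nhds hs)).congr_of_eventuallyEq
      (hEq.symm.eventuallyEq_of_mem (hopen.mem_nhds hs))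
  have hlipI : LipschitzWith K fun t : ℝ => G (t * Complex.I) := by
    refine LipschitzWith.of_dist_le_mul fun x y => (hlip.dist_le_mul _ _).trans_eq ?_
    rw [dist_eq_norm, ← sub_mul, norm_mul, Complex.norm_I, mul_one, ← Complex.ofReal_sub,
      Complex.norm_real, dist_eq_norm]
  filter_upwards [hlipI.ae_differentiableAt_real] with t ht
  set d := deriv (fun t : ℝ => G (t * Complex.I)) t with hd
  have hder : HasDerivAt (fun t : ℝ => G (t * Complex.I)) d t := ht.hasDerivAt
  refine ⟨-Complex.I * d, ?_⟩
  -- the primitive minus its first-order expansion at the boundary point, where its complex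
  -- derivative is `-I * d`, since `d` is the derivative in the direction `I`
  set G₁ : ℂ → ℂ := fun w => G (w + t * Complex.I) - G (t * Complex.I) + Complex.I * d * w with hG₁
  have hG₁der : ∀ w : ℂ, 0 < w.re →
      HasDerivAt G₁ (g (w + t * Complex.I) + Complex.I * d) w := by
    intro w hw
    have h1 := (hG (w + t * Complex.I) (by simpa using hw)).comp_add_const w (t * Complex.I)
    have h2 := (h1.sub_const (G (t * Complex.I))).add
      ((hasDerivAt_id w).const_mul (Complex.I * d))
    rw [mul_one] at h2
    exact h2
  have hG₁c : Continuous G₁ := by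
    have := hlip.continuous
    fun_prop
  have hG₁L : ∀ w, ‖G₁ w‖ ≤ (K + ‖d‖) * ‖w‖ := by
    intro w
    refine (norm_add_le _ _).trans ?_
    rw [add_mul]
    gcongr
    · rw [← dist_eq_norm]
      simpa using hlip.dist_le_mul (w + t * Complex.I) (t * Complex.I)
    · simp
  rw [Metric.tendsto_nhds]
  intro ε' hε'
  -- Cauchy's estimate on a disc of radius `θ / 2` loses a factor `8`
  set ε := ε' / 12 with hε
  have hε0 : 0 < ε := by positivity
  obtain ⟨δ, hδ, hsmall⟩ : ∃ δ > 0, ∀ y : ℝ, |y| ≤ δ → ‖G₁ (y * Complex.I)‖ ≤ ε * |y| := by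
    have := (hasDerivAt_iff_isLittleO_nhds_zero.1 hder).def hε0
    obtain ⟨δ, hδ, hb⟩ := Metric.eventually_nhds_iff.1 this
    refine ⟨δ / 2, by positivity, fun y hy => ?_⟩
    have h1 := @hb y (by rw [dist_zero_right, Real.norm_eq_abs]; linarith)
    rw [Real.norm_eq_abs] at h1
    refine le_trans (le_of_eq ?_) h1
    congr 1
    simp only [hG₁, Complex.real_smul]
    push_cast
    have : Complex.I * d * (y * Complex.I) = - (y * d) := by
      linear_combination (d * y) * Complex.I_mul_I
    rw [this]
    ring_nf
  obtain ⟨C, hC, hb⟩ := exists_norm_le_mul_exp_of_norm_le_on_segment hG₁c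
    (fun w hw => (hG₁der w hw).differentiableAt.differentiableWithinAt) hG₁L hε0 hδ hsmall
  have hev : ∀ᶠ θ : ℝ in 𝓝[>] 0, Real.exp (C * (2 * θ)) < 2 := by
    have : Tendsto (fun θ : ℝ => Real.exp (C * (2 * θ))) (𝓝[>] 0) (𝓝 (Real.exp (C * (2 * 0)))) :=
      (Continuous.tendsto (by fun_prop) 0).mono_left nhdsWithin_le_nhds
    refine this.eventually (gt_mem_nhds ?_)
    simp
  filter_upwards [hev, Ioo_mem_nhdsGT (show (0 : ℝ) < δ / 4 by positivity)] with θ hθe hθ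
  obtain ⟨hθ0, hθ1⟩ := hθ
  rw [dist_eq_norm, neg_mul, sub_neg_eq_add, ← (hG₁der θ (by simpa using hθ0)).deriv]
  have hre : ∀ z ∈ Metric.closedBall (θ : ℂ) (θ / 2), |z.re - θ| ≤ θ / 2 ∧ |z.im| ≤ θ / 2 := by
    intro z hz
    rw [mem_closedBall_iff_norm] at hz
    constructor
    · simpa using (Complex.abs_re_le_norm (z - θ)).trans hz
    · simpa using (Complex.abs_im_le_norm (z - θ)).trans hz
  have hcauchy : ‖deriv G₁ θ‖ ≤ (4 * ε * θ) / (θ / 2) := by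
    refine Complex.norm_deriv_le_of_forall_mem_sphere_norm_le (by positivity) ?_ ?_
    · refine DifferentiableOn.diffContOnCl ?_
      rw [closure_ball _ (by positivity)]
      intro z hz
      refine (hG₁der z ?_).differentiableAt.differentiableWithinAt
      have := abs_le.1 (hre z hz).1
      linarith
    · intro z hz
      have hz' := hre z (Metric.sphere_subset_closedBall hz)
      have h1 := abs_le.1 hz'.1
      have hnz : ‖z‖ ≤ 2 * θ := by
        have := Complex.norm_le_abs_re_add_abs_im z
        rw [abs_of_pos (by linarith)] at this
        linarith [hz'.2]
      refine (hb z (by linarith) (by linarith) (by linarith)).trans ?_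
      calc ε * ‖z‖ * Real.exp (C * ‖z‖) ≤ ε * (2 * θ) * Real.exp (C * (2 * θ)) := by gcongr
        _ ≤ ε * (2 * θ) * 2 := by gcongr
        _ = 4 * ε * θ := by ring
  refine hcauchy.trans_lt ?_
  have : 4 * ε * θ / (θ / 2) = 8 * ε := by field_simp; norm_num
  rw [this, hε]
  linarith

/-! ### Unconditional sums of products and the Poisson kernel -/

lemma hasSum_prod_fin {ι : Type*} (n : ℕ) {f : Fin n → ι → ℂ} {a : Fin n → ℂ}
    (hs : ∀ j, Summable fun k => ‖f j k‖) (ha : ∀ j, HasSum (f j) (a j)) :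
    (Summable fun β : Fin n → ι => ‖∏ j, f j (β j)‖) ∧
      HasSum (fun β : Fin n → ι => ∏ j, f j (β j)) (∏ j, a j) := by
  induction n with
  | zero =>
    refine ⟨(hasSum_unique _).summable, ?_⟩
    simp
  | succ n ih =>
    obtain ⟨h1, h2⟩ := ih (f := fun j => f j.succ) (fun j => hs j.succ) fun j => ha j.succ
    have hsum := (hs 0).mul_norm h1
    have hmul := (ha 0).mul h2 hsum.of_norm
    let e : ι × (Fin n → ι) ≃ (Fin (n + 1) → ι) := Fin.consEquiv fun _ => ι
    constructor
    · rw [← e.summable_iff]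
      refine hsum.congr fun x => ?_
      simp [e, Fin.prod_univ_succ]
    · rw [← e.hasSum_iff, Fin.prod_univ_succ]
      refine hmul.congr_fun fun x => ?_
      simp [e, Fin.prod_univ_succ]

/-- Summation over finitely supported multi-indices of a product of terms that are trivial from the
`n`-th coordinate on. -/
lemma hasSum_finsupp_prod {ι : Type*} [Zero ι] (n : ℕ) {f : ℕ → ι → ℂ} {a : ℕ → ℂ}
    (h0 : ∀ j, f j 0 = 1) (hz : ∀ j, n ≤ j → ∀ k, k ≠ 0 → f j k = 0)
    (hs : ∀ j < n, Summable fun k => ‖f j k‖) (ha : ∀ j < n, HasSum (f j) (a j)) :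
    (Summable fun β : ℕ →₀ ι => ‖β.prod f‖) ∧
      HasSum (fun β : ℕ →₀ ι => β.prod f) (∏ j ∈ Finset.range n, a j) := by
  obtain ⟨h1, h2⟩ := hasSum_prod_fin n (f := fun j => f j) (fun j => hs j j.2) fun j => ha j j.2
  let e : (Fin n → ι) → (ℕ →₀ ι) :=
    fun β => (Finsupp.equivFunOnFinite.symm β).embDomain Fin.valEmbedding
  have he : Function.Injective e :=
    (Finsupp.embDomain_injective Fin.valEmbedding).comp Finsupp.equivFunOnFinite.symm.injective
  have hprod : ∀ β, (e β).prod f = ∏ j : Fin n, f j (β j) := by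
    intro β
    rw [Finsupp.prod_embDomain, Finsupp.prod_fintype _ _ (fun j => h0 _)]
    simp
  have hout : ∀ β ∉ Set.range e, β.prod f = 0 := by
    intro β hβ
    have : ∃ j, n ≤ j ∧ β j ≠ 0 := by
      by_contra! hcon
      refine hβ ⟨fun j => β j, ?_⟩
      ext j
      by_cases hj : j < n
      · exact Finsupp.embDomain_apply_self Fin.valEmbedding _ (⟨j, hj⟩ : Fin n)
      · rw [hcon j (not_lt.1 hj)]
        refine Finsupp.embDomain_of_notMem_range _ _ _ ?_
        rintro ⟨i, rfl⟩
        exact hj i.2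
    obtain ⟨j, hj, hβj⟩ := this
    exact Finset.prod_eq_zero (Finsupp.mem_support_iff.2 hβj) (hz j hj _ hβj)
  constructor
  · rw [← he.summable_iff fun β hβ => by rw [hout β hβ, norm_zero]]
    exact h1.congr fun β => by simp [hprod]
  · rw [← he.hasSum_iff hout, ← Fin.prod_univ_eq_prod_range]
    exact h2.congr_fun hprod

/-- The coefficient of `conj (w ^ k)` in the Fourier expansion of the Poisson kernel at `z`. -/
def poissonCoeff (z : ℂ) : ℤ → ℂ
  | Int.ofNat k => z ^ k
  | Int.negSucc k => (starRingEnd ℂ) z ^ (k + 1)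

lemma poissonCoeff_natCast (z : ℂ) (k : ℕ) : poissonCoeff z k = z ^ k := rfl

lemma poissonCoeff_neg_succ (z : ℂ) (k : ℕ) :
    poissonCoeff z (-(k + 1)) = (starRingEnd ℂ) z ^ (k + 1) := by
  rw [← Int.negSucc_eq]
  rfl

/-- The Poisson kernel of the unit disc at `z`, as a function on the circle. As `w` is unimodular,
it equals `(1 - |z|²) / |1 - z conj w|²`. -/
def poissonKernel (z : ℂ) (w : Circle) : ℝ :=
  (1 - ‖z * (starRingEnd ℂ) w‖ ^ 2) / ‖1 - z * (starRingEnd ℂ) w‖ ^ 2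

lemma poissonKernel_nonneg {z : ℂ} (hz : ‖z‖ < 1) (w : Circle) : 0 ≤ poissonKernel z w := by
  refine div_nonneg ?_ (by positivity)
  rw [norm_mul, RCLike.norm_conj, Circle.norm_coe, mul_one, sub_nonneg]
  exact pow_le_one₀ (norm_nonneg _) hz.le

lemma summable_norm_poissonCoeff {z : ℂ} (hz : ‖z‖ < 1) :
    Summable fun k => ‖poissonCoeff z k‖ := by
  have h := summable_geometric_of_lt_one (norm_nonneg z) hz
  refine Summable.of_nat_of_neg_add_one ?_ ?_
  · exact h.congr fun k => by rw [poissonCoeff_natCast, norm_pow]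
  · exact ((summable_nat_add_iff 1).2 h).congr fun k => by
      rw [poissonCoeff_neg_succ, norm_pow, RCLike.norm_conj]

lemma hasSum_poissonCoeff {z : ℂ} (hz : ‖z‖ < 1) (w : Circle) :
    HasSum (fun k : ℤ => poissonCoeff z k * (starRingEnd ℂ) ((w ^ k : Circle) : ℂ))
      (poissonKernel z w) := by
  set u : ℂ := z * (starRingEnd ℂ) w with hu
  have hnu : ‖u‖ < 1 := by
    rwa [hu, norm_mul, RCLike.norm_conj, Circle.norm_coe, mul_one]
  have hnu' : ‖(starRingEnd ℂ) u‖ < 1 := by rwa [RCLike.norm_conj]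
  have h1 : HasSum (fun k : ℕ => poissonCoeff z k * (starRingEnd ℂ) ((w ^ (k : ℤ) : Circle) : ℂ))
      (1 - u)⁻¹ := by
    refine (hasSum_geometric_of_norm_lt_one hnu).congr_fun fun k => ?_
    rw [poissonCoeff_natCast, zpow_natCast, Circle.coe_pow, map_pow, ← mul_pow]
  have h2 : HasSum (fun k : ℕ => poissonCoeff z (-(k + 1)) *
      (starRingEnd ℂ) ((w ^ (-(k + 1) : ℤ) : Circle) : ℂ))
      ((starRingEnd ℂ) u * (1 - (starRingEnd ℂ) u)⁻¹) := by
    refine ((hasSum_geometric_of_norm_lt_one hnu').mul_left _).congr_fun fun k => ?_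
    rw [poissonCoeff_neg_succ, ← Int.negSucc_eq, zpow_negSucc, ← pow_succ', hu, map_mul,
      Complex.conj_conj, mul_pow, Circle.coe_inv_eq_conj, Complex.conj_conj, Circle.coe_pow]
  rw [show ((poissonKernel z w : ℝ) : ℂ) =
    (1 - u)⁻¹ + (starRingEnd ℂ) u * (1 - (starRingEnd ℂ) u)⁻¹ from ?_]
  · exact h1.of_nat_of_neg_add_one h2
  have hne : 1 - u ≠ 0 := sub_ne_zero.2 fun h => by rw [← h, norm_one] at hnu; exact hnu.false
  have hne' : 1 - (starRingEnd ℂ) u ≠ 0 :=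
    sub_ne_zero.2 fun h => by rw [← h, norm_one] at hnu'; exact hnu'.false
  rw [poissonKernel, ← hu]
  push_cast
  rw [← Complex.mul_conj', ← Complex.mul_conj', map_sub, map_one]
  field_simp
  ring

/-! ### Monomials on the infinite torus -/

instance instIsMulLeftInvariantHaarTorus : haarTorus.IsMulLeftInvariant := by
  unfold haarTorus; infer_instance

instance instRegularHaarTorus : haarTorus.Regular := by
  unfold haarTorus; infer_instance

lemma torusMonomial_eq_prod (β : ℕ →₀ ℤ) (τ : Torus) :
    torusMonomial β τ = β.prod fun j k => ((τ j ^ k : Circle) : ℂ) :=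
  map_finsuppProd Circle.coeHom _ _

lemma norm_torusMonomial (β : ℕ →₀ ℤ) (τ : Torus) : ‖torusMonomial β τ‖ = 1 :=
  Circle.norm_coe _

lemma continuous_torusMonomial (β : ℕ →₀ ℤ) : Continuous (torusMonomial β) := by
  unfold torusMonomial Finsupp.prod
  fun_prop

lemma torusMonomial_mul (β : ℕ →₀ ℤ) (σ τ : Torus) :
    torusMonomial β (σ * τ) = torusMonomial β σ * torusMonomial β τ := by
  simp only [torusMonomial, ← Circle.coe_mul, ← Finsupp.prod_mul, Pi.mul_apply, mul_zpow]

lemma torusMonomial_add (β γ : ℕ →₀ ℤ) (τ : Torus) :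
    torusMonomial (β + γ) τ = torusMonomial β τ * torusMonomial γ τ := by
  rw [torusMonomial, Finsupp.prod_add_index' (by simp) (by simp [zpow_add]), Circle.coe_mul]
  rfl

lemma torusMonomial_neg (β : ℕ →₀ ℤ) (τ : Torus) :
    torusMonomial (-β) τ = (starRingEnd ℂ) (torusMonomial β τ) := by
  rw [torusMonomial, torusMonomial, ← Circle.coe_inv_eq_conj, Finsupp.prod_neg_index (by simp)]
  simp [Finsupp.prod]

lemma torusMonomial_zero (τ : Torus) : torusMonomial 0 τ = 1 := by
  simp [torusMonomial]

lemma integral_torusMonomial (β : ℕ →₀ ℤ) :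
    ∫ τ, torusMonomial β τ ∂haarTorus = if β = 0 then 1 else 0 := by
  split_ifs with h
  · simp [h, torusMonomial_zero]
  obtain ⟨j, hj⟩ : ∃ j, β j ≠ 0 := by
    by_contra! hcon
    exact h (Finsupp.ext hcon)
  -- translation by the following `σ` multiplies the integral by `-1`
  let σ : Torus := Function.update 1 j (Circle.exp (Real.pi / β j))
  have hσ : torusMonomial β σ = -1 := by
    have hj' : (β j : ℝ) ≠ 0 := by exact_mod_cast hj
    have hprod : (β.prod fun j k => σ j ^ k) = Circle.exp Real.pi := by
      rw [Finsupp.prod, Finset.prod_eq_single j]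
      · rw [show σ j = Circle.exp (Real.pi / β j) from Function.update_self .., ←
          Circle.exp_intCast_mul, mul_div_cancel₀ _ hj']
      · intro i _ hi
        simp [σ, Function.update_of_ne hi]
      · exact fun hj' => absurd (Finsupp.mem_support_iff.2 hj) hj'
    rw [torusMonomial, hprod, Circle.coe_exp, Complex.exp_pi_mul_I]
  have := integral_mul_left_eq_self (μ := haarTorus) (torusMonomial β) σ
  simp only [torusMonomial_mul, hσ, integral_const_mul] at this
  linear_combination (-1 / 2) * this

lemma fourierCoefficient_torusMonomial (γ β : ℕ →₀ ℤ) :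
    fourierCoefficient (torusMonomial γ) β = if γ = β then 1 else 0 := by
  simp only [fourierCoefficient, ← torusMonomial_neg, ← torusMonomial_add, integral_torusMonomial,
    ← sub_eq_add_neg, sub_eq_zero]

/-! ### Products of Poisson kernels -/

/-- The coefficient of `conj (τ ^ β)` in the product of the Poisson kernels at the first `n`
coordinates of `z`. -/
def poissonMultiCoeff (n : ℕ) (z : ℕ → ℂ) (β : ℕ →₀ ℤ) : ℂ :=
  β.prod fun j k => poissonCoeff (truncate n z j) k

lemma poissonCoeff_zero_right (z : ℂ) : poissonCoeff z 0 = 1 := pow_zero z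

lemma poissonCoeff_zero_left {k : ℤ} (hk : k ≠ 0) : poissonCoeff 0 k = 0 := by
  rcases k with k | k
  · rw [poissonCoeff]
    exact zero_pow (by simpa using hk)
  · simp [poissonCoeff]

lemma truncate_of_lt {n j : ℕ} (h : j < n) (z : ℕ → ℂ) : truncate n z j = z j := if_pos h

lemma truncate_of_le {n j : ℕ} (h : n ≤ j) (z : ℕ → ℂ) : truncate n z j = 0 := if_neg h.not_gt

lemma hasSum_poissonMultiCoeff {n : ℕ} {z : ℕ → ℂ} (hz : ∀ j < n, ‖z j‖ < 1) (τ : Torus) :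
    (Summable fun β => ‖poissonMultiCoeff n z β‖) ∧
      HasSum (fun β => poissonMultiCoeff n z β * (starRingEnd ℂ) (torusMonomial β τ))
        ((∏ j ∈ Finset.range n, poissonKernel (z j) (τ j) : ℝ) : ℂ) := by
  obtain ⟨h1, h2⟩ := hasSum_finsupp_prod n
    (f := fun j k => poissonCoeff (truncate n z j) k * (starRingEnd ℂ) ((τ j ^ k : Circle) : ℂ))
    (a := fun j => poissonKernel (z j) (τ j)) (fun j => by simp [poissonCoeff_zero_right])
    (fun j hj k hk => by rw [truncate_of_le hj, poissonCoeff_zero_left hk, zero_mul])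
    (fun j hj => by
      simpa only [truncate_of_lt hj, norm_mul, RCLike.norm_conj, Circle.norm_coe, mul_one]
        using summable_norm_poissonCoeff (hz j hj))
    (fun j hj => by
      simpa only [truncate_of_lt hj] using hasSum_poissonCoeff (hz j hj) (τ j))
  have hprod : ∀ β : ℕ →₀ ℤ, (β.prod fun j k => poissonCoeff (truncate n z j) k *
      (starRingEnd ℂ) ((τ j ^ k : Circle) : ℂ)) =
      poissonMultiCoeff n z β * (starRingEnd ℂ) (torusMonomial β τ) := by
    intro β
    rw [Finsupp.prod_mul, torusMonomial_eq_prod, map_finsuppProd]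
    rfl
  simp only [hprod] at h1 h2
  refine ⟨?_, ?_⟩
  · simpa [norm_torusMonomial] using h1
  · push_cast
    exact h2

lemma integrable_mul_bounded {f g : Torus → ℂ} {M : ℝ} (hf : AEStronglyMeasurable f haarTorus)
    (hM : ∀ᵐ τ ∂haarTorus, ‖f τ‖ ≤ M) (hg : Continuous g) :
    Integrable (fun τ => f τ * g τ) haarTorus :=
  (hg.integrable_of_hasCompactSupport (HasCompactSupport.of_compactSpace g)).bdd_mul hf hM

/-- The Poisson integral in finitely many variables, expanded in Fourier coefficients of `f`. -/
lemma hasSum_integral_mul_poissonKernel {f : Torus → ℂ} {M : ℝ}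
    (hf : AEStronglyMeasurable f haarTorus) (hM : ∀ᵐ τ ∂haarTorus, ‖f τ‖ ≤ M) {n : ℕ}
    {z : ℕ → ℂ} (hz : ∀ j < n, ‖z j‖ < 1) :
    HasSum (fun β => poissonMultiCoeff n z β * fourierCoefficient f β)
      (∫ τ, f τ * (∏ j ∈ Finset.range n, poissonKernel (z j) (τ j) : ℝ) ∂haarTorus) := by
  have hsum := (hasSum_poissonMultiCoeff hz 1).1
  have h := hasSum_integral_of_dominated_convergence (μ := haarTorus)
    (F := fun β τ => f τ * (poissonMultiCoeff n z β * (starRingEnd ℂ) (torusMonomial β τ)))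
    (f := fun τ => f τ * (∏ j ∈ Finset.range n, poissonKernel (z j) (τ j) : ℝ))
    (fun β _ => M * ‖poissonMultiCoeff n z β‖)
    (fun β => hf.mul (((continuous_torusMonomial β).star.const_mul _).aestronglyMeasurable))
    (fun β => by
      filter_upwards [hM] with τ hτ
      rw [norm_mul, norm_mul, RCLike.norm_conj, norm_torusMonomial, mul_one]
      gcongr)
    (Eventually.of_forall fun τ => hsum.mul_left M) (integrable_const _)
    (Eventually.of_forall fun τ => (hasSum_poissonMultiCoeff hz τ).2.mul_left _)
  refine h.congr_fun fun β => ?_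
  rw [fourierCoefficient, ← integral_const_mul]
  congr 1 with τ
  ring

/-- The product of Poisson kernels has integral `1`: it is the Poisson integral of the constant
function. -/
lemma integral_poissonKernel {n : ℕ} {z : ℕ → ℂ} (hz : ∀ j < n, ‖z j‖ < 1) :
    ∫ τ : Torus, ∏ j ∈ Finset.range n, poissonKernel (z j) (τ j) ∂haarTorus = 1 := by
  have h := hasSum_integral_mul_poissonKernel (f := torusMonomial 0) (M := 1)
    (continuous_torusMonomial 0).aestronglyMeasurable
    (Eventually.of_forall fun τ => (norm_torusMonomial 0 τ).le) hz
  have h0 := hasSum_single (f := fun β => poissonMultiCoeff n z β *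
    fourierCoefficient (torusMonomial 0) β) 0
    (fun β hβ => by simp [fourierCoefficient_torusMonomial, hβ.symm])
  have := h.unique h0
  simp only [torusMonomial_zero, one_mul, integral_complex_ofReal, poissonMultiCoeff,
    fourierCoefficient_torusMonomial, Finsupp.prod_zero_index, if_true] at this
  exact_mod_cast this

lemma norm_integral_mul_poissonKernel_le {f : Torus → ℂ} {M : ℝ}
    (hM : ∀ᵐ τ ∂haarTorus, ‖f τ‖ ≤ M) {n : ℕ} {z : ℕ → ℂ} (hz : ∀ j < n, ‖z j‖ < 1) :
    ‖∫ τ, f τ * (∏ j ∈ Finset.range n, poissonKernel (z j) (τ j) : ℝ) ∂haarTorus‖ ≤ M := by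
  have hint : Integrable (fun τ : Torus => ∏ j ∈ Finset.range n, poissonKernel (z j) (τ j))
      haarTorus := by
    by_contra h
    have := integral_poissonKernel hz
    rw [integral_undef h] at this
    exact zero_ne_one this
  calc _ ≤ ∫ τ : Torus, M * ∏ j ∈ Finset.range n, poissonKernel (z j) (τ j) ∂haarTorus := by
        refine norm_integral_le_of_norm_le (hint.const_mul M) ?_
        filter_upwards [hM] with τ hτ
        have h0 : 0 ≤ ∏ j ∈ Finset.range n, poissonKernel (z j) (τ j) :=
          Finset.prod_nonneg fun j hj => poissonKernel_nonneg (hz j (Finset.mem_range.1 hj)) _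
        rw [norm_mul, Complex.norm_real, Real.norm_of_nonneg h0]
        gcongr
    _ = M := by rw [integral_const_mul, integral_poissonKernel hz, mul_one]

/-! ### Bounded analytic functions at points with finitely many coordinates -/

/-- The inclusion of nonnegative multi-indices into integer multi-indices. -/
def natIndex (β : ℕ →₀ ℕ) : ℕ →₀ ℤ := β.mapRange (fun k : ℕ => (k : ℤ)) rfl

lemma natIndex_apply (β : ℕ →₀ ℕ) (j : ℕ) : natIndex β j = β j := by simp [natIndex]

lemma natIndex_injective : Function.Injective natIndex :=
  Finsupp.mapRange_injective _ rfl Nat.cast_injective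

lemma exists_neg_of_notMem_range_natIndex {β : ℕ →₀ ℤ} (hβ : β ∉ Set.range natIndex) :
    ∃ j, β j < 0 := by
  by_contra! h
  refine hβ ⟨β.mapRange Int.toNat rfl, ?_⟩
  ext j
  simp [natIndex_apply, h j]

/-- `f` is a measurable function on the infinite torus, bounded by `M` almost everywhere, whose
Fourier coefficients with a negative index vanish: membership in `H^∞(𝔻^∞)` for functions instead
of classes. -/
structure IsAnalyticBounded (f : Torus → ℂ) (M : ℝ) : Prop where
  aestronglyMeasurable : AEStronglyMeasurable f haarTorus
  norm_le : ∀ᵐ τ ∂haarTorus, ‖f τ‖ ≤ M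
  analytic : ∀ β : ℕ →₀ ℤ, (∃ j, β j < 0) → fourierCoefficient f β = 0

variable {f : Torus → ℂ} {M : ℝ}

/-- For analytic `f` the power series and the Poisson integral agree, because the Poisson
coefficient with a nonnegative index is the monomial. -/
lemma IsAnalyticBounded.hasSum_powerSeriesTerm (hf : IsAnalyticBounded f M) {n : ℕ} {z : ℕ → ℂ}
    (hz : ∀ j < n, ‖z j‖ < 1) :
    HasSum (powerSeriesTerm f (truncate n z))
      (∫ τ, f τ * (∏ j ∈ Finset.range n, poissonKernel (z j) (τ j) : ℝ) ∂haarTorus) := by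
  have h := hasSum_integral_mul_poissonKernel hf.aestronglyMeasurable hf.norm_le hz
  rw [← natIndex_injective.hasSum_iff] at h
  · refine h.congr_fun fun β => ?_
    rw [Function.comp_apply, mul_comm, poissonMultiCoeff, natIndex, powerSeriesTerm,
      Finsupp.prod_mapRange_index (fun j => poissonCoeff_zero_right _)]
    rfl
  · intro β hβ
    rw [hf.analytic β (exists_neg_of_notMem_range_natIndex hβ), mul_zero]

/-- The sum of the power series of `f` at `(z 0, …, z (n - 1), 0, 0, …)`. -/
def partialValue (f : Torus → ℂ) (n : ℕ) (z : ℕ → ℂ) : ℂ :=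
  ∑' β, powerSeriesTerm f (truncate n z) β

lemma IsAnalyticBounded.norm_partialValue_le (hf : IsAnalyticBounded f M) {n : ℕ} {z : ℕ → ℂ}
    (hz : ∀ j < n, ‖z j‖ < 1) : ‖partialValue f n z‖ ≤ M := by
  rw [partialValue, (hf.hasSum_powerSeriesTerm hz).tsum_eq]
  exact norm_integral_mul_poissonKernel_le hf.norm_le hz

lemma norm_fourierCoefficient_le (hM : ∀ᵐ τ ∂haarTorus, ‖f τ‖ ≤ M) (β : ℕ →₀ ℤ) :
    ‖fourierCoefficient f β‖ ≤ M := by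
  refine (norm_integral_le_of_norm_le_const (C := M) ?_).trans_eq (by simp)
  filter_upwards [hM] with τ hτ
  rwa [norm_mul, RCLike.norm_conj, norm_torusMonomial, mul_one]

/-- The monomial `z^β` in the first `n` coordinates of `z`; it vanishes if `β` involves another
coordinate. -/
def truncatedMonomial (n : ℕ) (z : ℕ → ℂ) (β : ℕ →₀ ℕ) : ℂ :=
  β.prod fun j k => truncate n z j ^ k

lemma summable_norm_truncatedMonomial {n : ℕ} {z : ℕ → ℂ} (hz : ∀ j < n, ‖z j‖ < 1) :
    Summable fun β => ‖truncatedMonomial n z β‖ := by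
  refine (hasSum_finsupp_prod n (f := fun j k => truncate n z j ^ k)
    (a := fun j => (1 - z j)⁻¹) (fun j => pow_zero _)
    (fun j hj k hk => by rw [truncate_of_le hj, zero_pow hk]) (fun j hj => ?_) fun j hj => ?_).1
  · simpa [truncate_of_lt hj] using summable_geometric_of_lt_one (norm_nonneg _) (hz j hj)
  · simpa [truncate_of_lt hj] using hasSum_geometric_of_norm_lt_one (hz j hj)

lemma norm_powerSeriesTerm_le (hM : ∀ᵐ τ ∂haarTorus, ‖f τ‖ ≤ M) {n : ℕ} {z r : ℕ → ℂ}
    (hr : ∀ j < n, ‖z j‖ ≤ ‖r j‖) (β : ℕ →₀ ℕ) :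
    ‖powerSeriesTerm f (truncate n z) β‖ ≤ M * ‖truncatedMonomial n r β‖ := by
  have h := norm_fourierCoefficient_le hM (natIndex β)
  have hM0 : 0 ≤ M := (norm_nonneg _).trans h
  rw [powerSeriesTerm, norm_mul]
  refine mul_le_mul h ?_ (norm_nonneg _) hM0
  rw [truncatedMonomial, Finsupp.prod, Finsupp.prod, norm_prod, norm_prod]
  refine Finset.prod_le_prod (fun _ _ => norm_nonneg _) fun j _ => ?_
  rw [norm_pow, norm_pow]
  gcongr
  by_cases hj : j < n
  · rw [truncate_of_lt hj, truncate_of_lt hj]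
    exact hr j hj
  · rw [truncate_of_le (not_lt.1 hj), truncate_of_le (not_lt.1 hj)]

/-- The values at points with finitely many coordinates depend holomorphically on the point, along a
holomorphic family that stays in a compact polydisc. -/
lemma differentiableOn_partialValue (hM : ∀ᵐ τ ∂haarTorus, ‖f τ‖ ≤ M) {n : ℕ} {U : Set ℂ}
    (hU : IsOpen U) {z : ℂ → ℕ → ℂ} (hz : ∀ j, DifferentiableOn ℂ (fun s => z s j) U)
    {r : ℕ → ℂ} (hr1 : ∀ j < n, ‖r j‖ < 1) (hr : ∀ s ∈ U, ∀ j < n, ‖z s j‖ ≤ ‖r j‖) :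
    DifferentiableOn ℂ (fun s => partialValue f n (z s)) U := by
  refine Complex.differentiableOn_tsum_of_summable_norm
    ((summable_norm_truncatedMonomial hr1).mul_left M) (fun β => ?_) hU
    fun β s hs => norm_powerSeriesTerm_le hM (hr s hs) β
  unfold powerSeriesTerm Finsupp.prod
  refine DifferentiableOn.const_mul (DifferentiableOn.fun_finsetProd fun j _ => ?_) _
  refine DifferentiableOn.pow ?_ _
  by_cases hj : j < n
  · simpa only [truncate_of_lt hj] using hz j
  · simpa only [truncate_of_le (not_lt.1 hj)] using differentiableOn_const 0

/-! ### Values on `𝔻^∞ ∩ c₀` -/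

lemma truncate_truncate {m n : ℕ} (h : m ≤ n) (z : ℕ → ℂ) :
    truncate n (truncate m z) = truncate m z := by
  ext j
  by_cases hj : j < n
  · rw [truncate_of_lt hj]
  · rw [truncate_of_le (not_lt.1 hj), truncate_of_le (h.trans (not_lt.1 hj))]

/-- The Schwarz lemma, applied on the disc of radius `1 / ρ'` to `s ↦ F(z_0, …, z_{m-1}, s z_m, …)`.
The radius `ρ' > ρ` keeps the coordinates of this family in a compact polydisc. -/
lemma IsAnalyticBounded.norm_partialValue_sub_le (hf : IsAnalyticBounded f M) {m n : ℕ}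
    (hmn : m ≤ n) {z : ℕ → ℂ} (hz : ∀ j, ‖z j‖ < 1) {ρ ρ' : ℝ} (hρ : 0 ≤ ρ) (hρρ' : ρ < ρ')
    (hρ' : ρ' < 1) (hzρ : ∀ j, m ≤ j → ‖z j‖ ≤ ρ) :
    ‖partialValue f n z - partialValue f m z‖ ≤ 2 * M * ρ' := by
  have hρ'0 : 0 < ρ' := hρ.trans_lt hρρ'
  let w : ℂ → ℕ → ℂ := fun s j => if j < m then z j else s * z j
  let r : ℕ → ℂ := fun j => if j < m then z j else ((ρ / ρ' : ℝ) : ℂ)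
  have hr1 : ∀ j, ‖r j‖ < 1 := by
    intro j
    simp only [r]
    split_ifs
    · exact hz j
    · rw [Complex.norm_real, Real.norm_of_nonneg (by positivity)]
      exact (div_lt_one hρ'0).2 hρρ'
  have hr : ∀ s ∈ Metric.ball (0 : ℂ) (1 / ρ'), ∀ j, ‖w s j‖ ≤ ‖r j‖ := by
    intro s hs j
    simp only [w, r]
    split_ifs with hj
    · rfl
    · rw [Complex.norm_real, Real.norm_of_nonneg (by positivity), norm_mul]
      calc ‖s‖ * ‖z j‖ ≤ 1 / ρ' * ρ := by
            gcongr
            · exact (mem_ball_zero_iff.1 hs).le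
            · exact hzρ j (not_lt.1 hj)
        _ = ρ / ρ' := by ring
  have hw0 : partialValue f n (w 0) = partialValue f m z := by
    have : w 0 = truncate m z := by
      ext j
      simp [w, truncate]
    rw [this, partialValue, truncate_truncate hmn, partialValue]
  have hw1 : partialValue f n (w 1) = partialValue f n z := by
    have : w 1 = z := by
      ext j
      simp [w]
    rw [this]
  have hM : ∀ s ∈ Metric.ball (0 : ℂ) (1 / ρ'), ‖partialValue f n (w s)‖ ≤ M := fun s hs =>
    hf.norm_partialValue_le fun j _ => (hr s hs j).trans_lt (hr1 j)
  have h0 : (0 : ℂ) ∈ Metric.ball (0 : ℂ) (1 / ρ') := Metric.mem_ball_self (by positivity)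
  have hd : DifferentiableOn ℂ (fun s => partialValue f n (w s)) (Metric.ball 0 (1 / ρ')) := by
    refine differentiableOn_partialValue hf.norm_le Metric.isOpen_ball (fun j => ?_)
      (fun j _ => hr1 j) fun s hs j _ => hr s hs j
    by_cases hj : j < m
    · simp only [w, hj, if_true]
      fun_prop
    · simp only [w, hj, if_false]
      fun_prop
  have h := Complex.dist_le_div_mul_dist_of_mapsTo_ball (R₂ := 2 * M) (z := 1) hd
    (fun s hs => by
      rw [mem_closedBall_iff_norm]
      linarith [norm_sub_le (partialValue f n (w s)) (partialValue f n (w 0)), hM s hs, hM 0 h0])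
    (by
      rw [mem_ball_zero_iff, norm_one]
      exact (one_lt_div hρ'0).2 hρ')
  rw [hw0, hw1, dist_eq_norm] at h
  simpa using h

/-- Radii for which the estimate of `IsAnalyticBounded.norm_partialValue_sub_le` is below `ε`. -/
lemma exists_radius (M : ℝ) {ε : ℝ} (hε : 0 < ε) : ∃ ρ > 0, ∃ ρ' < 1, ρ < ρ' ∧ 2 * M * ρ' < ε := by
  have hc : Tendsto (fun x : ℝ => 2 * M * x) (𝓝[>] 0) (𝓝 (2 * M * 0)) :=
    (Continuous.tendsto (by fun_prop) 0).mono_left nhdsWithin_le_nhds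
  rw [mul_zero] at hc
  obtain ⟨x, hx, hx0, hx1⟩ :=
    ((hc.eventually (gt_mem_nhds hε)).and (Ioo_mem_nhdsGT one_pos)).exists
  exact ⟨x / 2, half_pos hx0, x, hx1, half_lt_self hx0, hx⟩

lemma IsAnalyticBounded.tendsto_partialValue (hf : IsAnalyticBounded f M) {z : ℕ → ℂ}
    (hz : z ∈ polydiscC0) :
    Tendsto (fun n => partialValue f n z) atTop (𝓝 (value f z)) := by
  refine tendsto_nhds_limUnder (cauchySeq_tendsto_of_complete (Metric.cauchySeq_iff'.2 ?_))
  intro ε hε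
  obtain ⟨ρ, hρ, ρ', hρ', hρρ', hlt⟩ := exists_radius M hε
  obtain ⟨N, hN⟩ := eventually_atTop.1
    (hz.2.norm.eventually_le_const (by simpa using hρ))
  refine ⟨N, fun n hn => ?_⟩
  rw [dist_eq_norm]
  exact (hf.norm_partialValue_sub_le hn hz.1 hρ.le hρρ' hρ' hN).trans_lt hlt

lemma IsAnalyticBounded.hasValue (hf : IsAnalyticBounded f M) {z : ℕ → ℂ} (hz : z ∈ polydiscC0) :
    HasValue f z (value f z) :=
  ⟨fun _ => (hf.hasSum_powerSeriesTerm fun j _ => hz.1 j).summable, hf.tendsto_partialValue hz⟩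

lemma IsAnalyticBounded.norm_value_le (hf : IsAnalyticBounded f M) {z : ℕ → ℂ}
    (hz : z ∈ polydiscC0) : ‖value f z‖ ≤ M :=
  le_of_tendsto (hf.tendsto_partialValue hz).norm
    (Eventually.of_forall fun _ => hf.norm_partialValue_le fun j _ => hz.1 j)

lemma IsAnalyticBounded.norm_value_sub_partialValue_le (hf : IsAnalyticBounded f M) {m : ℕ}
    {z : ℕ → ℂ} (hz : z ∈ polydiscC0) {ρ ρ' : ℝ} (hρ : 0 ≤ ρ) (hρρ' : ρ < ρ')
    (hρ' : ρ' < 1) (hzρ : ∀ j, m ≤ j → ‖z j‖ ≤ ρ) :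
    ‖value f z - partialValue f m z‖ ≤ 2 * M * ρ' :=
  le_of_tendsto ((hf.tendsto_partialValue hz).sub_const _).norm
    (eventually_atTop.2 ⟨m, fun _ hn =>
      hf.norm_partialValue_sub_le hn hz.1 hρ hρρ' hρ' hzρ⟩)

/-! ### Holomorphy along the orbits of the Kronecker flow -/

/-- The point `(p_j^{-s} τ_j)_j` for complex `s`: the contraction `b_θ` of the point `T_t τ` if
`s = θ + it`. -/
def orbit (τ : Torus) (s : ℂ) : ℕ → ℂ := fun j => Complex.exp (-s * Real.log (prime j)) * τ j

lemma one_lt_prime (j : ℕ) : 1 < prime j := (Nat.prime_nth_prime j).one_lt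

lemma log_prime_pos (j : ℕ) : 0 < Real.log (prime j) :=
  Real.log_pos (by exact_mod_cast one_lt_prime j)

lemma norm_orbit (τ : Torus) (s : ℂ) (j : ℕ) :
    ‖orbit τ s j‖ = Real.exp (-(s.re * Real.log (prime j))) := by
  rw [orbit, norm_mul, Circle.norm_coe, mul_one, Complex.norm_exp, neg_mul,
    Complex.neg_re, Complex.re_mul_ofReal]

lemma tendsto_exp_neg_mul_log_prime {c : ℝ} (hc : 0 < c) :
    Tendsto (fun j => Real.exp (-(c * Real.log (prime j)))) atTop (𝓝 0) := by
  have hp : Tendsto prime atTop atTop :=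
    (Nat.nth_strictMono Nat.infinite_setOfPred_prime).tendsto_atTop
  exact Real.tendsto_exp_neg_atTop_nhds_zero.comp
    ((Real.tendsto_log_atTop.comp (tendsto_natCast_atTop_atTop.comp hp)).const_mul_atTop hc)

lemma exp_neg_mul_log_prime_lt_one {c : ℝ} (hc : 0 < c) (j : ℕ) :
    Real.exp (-(c * Real.log (prime j))) < 1 := by
  rw [Real.exp_lt_one_iff]
  exact neg_neg_of_pos (mul_pos hc (log_prime_pos j))

lemma orbit_mem_polydiscC0 (τ : Torus) {s : ℂ} (hs : 0 < s.re) : orbit τ s ∈ polydiscC0 := by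
  refine ⟨fun j => ?_, ?_⟩
  · rw [norm_orbit]
    exact exp_neg_mul_log_prime_lt_one hs j
  · rw [tendsto_zero_iff_norm_tendsto_zero]
    simpa only [norm_orbit] using tendsto_exp_neg_mul_log_prime hs

lemma b_flow (θ t : ℝ) (τ : Torus) : b θ (flow t τ) = orbit τ (θ + t * Complex.I) := by
  ext j
  have hp : (0 : ℝ) < prime j := by exact_mod_cast (one_lt_prime j).le
  rw [b, orbit, flow, Circle.coe_mul, Circle.coe_exp, Real.rpow_def_of_pos hp, ← mul_assoc,
    Complex.ofReal_exp, ← Complex.exp_add]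
  congr 2
  push_cast
  ring

lemma flow_zero (τ : Torus) : flow 0 τ = τ := by
  ext j
  simp [flow]

lemma b_eq_orbit (θ : ℝ) (τ : Torus) : b θ τ = orbit τ θ := by
  have := b_flow θ 0 τ
  rwa [flow_zero, Complex.ofReal_zero, zero_mul, add_zero] at this

lemma b_mem_polydiscC0 {θ : ℝ} (hθ : 0 < θ) (τ : Torus) : b θ τ ∈ polydiscC0 := by
  rw [b_eq_orbit]
  exact orbit_mem_polydiscC0 τ (by simpa using hθ)

/-- On the half-plane `c < Re s` the values are a uniform limit of holomorphic functions, since the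
points of the orbit have the common majorant `p_j^{-c}` there. -/
lemma IsAnalyticBounded.differentiableOn_value_orbit (hf : IsAnalyticBounded f M) (τ : Torus) :
    DifferentiableOn ℂ (fun s => value f (orbit τ s)) {s | 0 < s.re} := by
  have hstrip : ∀ c : ℝ, 0 < c →
      DifferentiableOn ℂ (fun s => value f (orbit τ s)) {s | c < s.re} := by
    intro c hc
    have hopen : IsOpen {s : ℂ | c < s.re} := isOpen_lt continuous_const Complex.continuous_re
    have hle : ∀ s ∈ {s : ℂ | c < s.re}, ∀ j,
        ‖orbit τ s j‖ ≤ Real.exp (-(c * Real.log (prime j))) := by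
      intro s hs j
      rw [norm_orbit, Real.exp_le_exp, neg_le_neg_iff]
      exact mul_le_mul_of_nonneg_right (le_of_lt hs) (log_prime_pos j).le
    have hunif : TendstoUniformlyOn (fun n s => partialValue f n (orbit τ s))
        (fun s => value f (orbit τ s)) atTop {s | c < s.re} := by
      rw [Metric.tendstoUniformlyOn_iff]
      intro ε hε
      obtain ⟨ρ, hρ, ρ', hρ', hρρ', hlt⟩ := exists_radius M hε
      obtain ⟨N, hN⟩ := eventually_atTop.1
        ((tendsto_exp_neg_mul_log_prime hc).eventually (Iic_mem_nhds hρ))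
      filter_upwards [eventually_ge_atTop N] with n hn s hs
      rw [dist_eq_norm]
      refine (hf.norm_value_sub_partialValue_le (orbit_mem_polydiscC0 τ (hc.trans hs)) hρ.le hρρ'
        hρ' fun j hj => ?_).trans_lt hlt
      exact (hle s hs j).trans (hN j (hn.trans hj))
    refine hunif.tendstoLocallyUniformlyOn.differentiableOn (Eventually.of_forall fun n => ?_) hopen
    refine differentiableOn_partialValue hf.norm_le hopen (fun j => ?_)
      (r := fun j => (Real.exp (-(c * Real.log (prime j))) : ℝ)) (fun j _ => ?_) fun s hs j _ => ?_
    · unfold orbit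
      fun_prop
    · rw [Complex.norm_real, Real.norm_of_nonneg (Real.exp_pos _).le]
      exact exp_neg_mul_log_prime_lt_one hc j
    · rw [Complex.norm_real, Real.norm_of_nonneg (Real.exp_pos _).le]
      exact hle s hs j
  intro s hs
  have hs' : 0 < s.re := hs
  exact ((hstrip (s.re / 2) (half_pos hs')).differentiableAt
    ((isOpen_lt continuous_const Complex.continuous_re).mem_nhds
      (half_lt_self hs'))).differentiableWithinAt

lemma IsAnalyticBounded.ae_exists_tendsto_flow (hf : IsAnalyticBounded f M) (τ : Torus) :
    ∀ᵐ t : ℝ, ∃ l, Tendsto (fun θ : ℝ => value f (b θ (flow t τ))) (𝓝[>] 0) (𝓝 l) := by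
  simp only [b_flow]
  exact ae_exists_tendsto_of_bounded_on_halfPlane (g := fun s => value f (orbit τ s)) (M := M)
    (hf.differentiableOn_value_orbit τ) fun s hs => hf.norm_value_le (orbit_mem_polydiscC0 τ hs)

lemma IsAnalyticBounded.continuousOn_value_b (hf : IsAnalyticBounded f M) (τ : Torus) :
    ContinuousOn (fun θ : ℝ => value f (b θ τ)) (Set.Ioi 0) := by
  simp only [b_eq_orbit]
  have hmaps : Set.MapsTo (fun θ : ℝ => (θ : ℂ)) (Set.Ioi 0) {s : ℂ | 0 < s.re} :=
    fun θ hθ => by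
      rwa [Set.mem_ofPred_eq, Complex.ofReal_re]
  exact ContinuousOn.comp (g := fun s => value f (orbit τ s))
    (hf.differentiableOn_value_orbit τ).continuousOn Complex.continuous_ofReal.continuousOn hmaps

/-! ### Uniqueness of Fourier coefficients -/

lemma norm_mul_circle (x : ℂ) (w : Circle) : ‖x * w‖ = ‖x‖ := by
  rw [norm_mul, Circle.norm_coe, mul_one]

/-- The monomial `τ^β` as a continuous function on the torus. -/
def monomialMap (β : ℕ →₀ ℤ) : C(Torus, ℂ) := ⟨torusMonomial β, continuous_torusMonomial β⟩

/-- The star subalgebra of trigonometric polynomials on the infinite torus. -/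
def trigPolynomials : StarSubalgebra ℂ C(Torus, ℂ) where
  toSubalgebra := Algebra.adjoin ℂ (Set.range monomialMap)
  star_mem' := by
    change Algebra.adjoin ℂ (Set.range monomialMap) ≤
      star (Algebra.adjoin ℂ (Set.range monomialMap))
    refine Algebra.adjoin_le ?_
    rintro _ ⟨β, rfl⟩
    refine Algebra.subset_adjoin ⟨-β, ?_⟩
    ext τ
    exact torusMonomial_neg β τ

lemma trigPolynomials_toSubmodule :
    Subalgebra.toSubmodule trigPolynomials.toSubalgebra =
      Submodule.span ℂ (Set.range monomialMap) := by
  refine Algebra.adjoin_eq_span_of_subset _ (.trans (fun x => Submonoid.closure_induction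
    (fun _ => id) ⟨0, ?_⟩ ?_) Submodule.subset_span)
  · ext τ
    exact torusMonomial_zero τ
  · rintro _ _ _ _ ⟨β, rfl⟩ ⟨γ, rfl⟩
    refine ⟨β + γ, ?_⟩
    ext τ
    exact torusMonomial_add β γ τ

lemma trigPolynomials_topologicalClosure : trigPolynomials.topologicalClosure = ⊤ := by
  refine ContinuousMap.starSubalgebra_topologicalClosure_eq_top_of_separatesPoints _ ?_
  intro x y hxy
  obtain ⟨j, hj⟩ := Function.ne_iff.1 hxy
  refine ⟨_, ⟨monomialMap (Finsupp.single j 1), Algebra.subset_adjoin ⟨_, rfl⟩, rfl⟩, ?_⟩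
  simpa [monomialMap, torusMonomial, Circle.ext_iff] using hj

lemma dense_span_monomialMap :
    Dense (Submodule.span ℂ (Set.range monomialMap) : Set C(Torus, ℂ)) := by
  rw [← trigPolynomials_toSubmodule]
  intro x
  have hx : x ∈ trigPolynomials.topologicalClosure := by
    rw [trigPolynomials_topologicalClosure]
    trivial
  exact hx

/-- The trigonometric polynomials are dense in `L²`, and the Fourier coefficients are the inner
products with monomials. -/
lemma ae_eq_zero_of_fourierCoefficient_eq_zero {h : Torus → ℂ}
    (hm : AEStronglyMeasurable h haarTorus) (hM : ∀ᵐ τ ∂haarTorus, ‖h τ‖ ≤ M)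
    (h0 : ∀ β, fourierCoefficient h β = 0) : h =ᵐ[haarTorus] 0 := by
  have hL : MemLp h 2 haarTorus := MemLp.of_bound hm M hM
  let T := ContinuousMap.toLp (E := ℂ) 2 haarTorus ℂ
  have hinner : ∀ φ : C(Torus, ℂ), inner ℂ (T φ) (hL.toLp h) =
      ∫ τ, h τ * (starRingEnd ℂ) (φ τ) ∂haarTorus := by
    intro φ
    rw [L2.inner_def]
    refine integral_congr_ae ?_
    filter_upwards [ContinuousMap.coeFn_toLp (𝕜 := ℂ) haarTorus φ (p := 2), hL.coeFn_toLp]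
      with τ h1 h2
    rw [h1, h2]
    rfl
  have hall : ∀ φ : C(Torus, ℂ), inner ℂ (T φ) (hL.toLp h) = 0 := by
    have hclosed : IsClosed {φ : C(Torus, ℂ) | inner ℂ (T φ) (hL.toLp h) = 0} :=
      isClosed_eq (T.continuous.inner continuous_const) continuous_const
    intro φ
    refine (hclosed.closure_subset_iff (s := Submodule.span ℂ (Set.range monomialMap))).2 ?_
      (dense_span_monomialMap φ)
    intro ψ hψ
    induction hψ using Submodule.span_induction with
    | mem x hx =>
      obtain ⟨β, rfl⟩ := hx
      exact (hinner _).trans (h0 β)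
    | zero => simp
    | add x y _ _ hx hy =>
      have hx : inner ℂ (T x) (hL.toLp h) = 0 := hx
      have hy : inner ℂ (T y) (hL.toLp h) = 0 := hy
      change inner ℂ (T (x + y)) (hL.toLp h) = 0
      rw [map_add, inner_add_left, hx, hy, add_zero]
    | smul c x _ hx =>
      have hx : inner ℂ (T x) (hL.toLp h) = 0 := hx
      change inner ℂ (T (c • x)) (hL.toLp h) = 0
      rw [map_smul, inner_smul_left, hx, mul_zero]
  have hzero : hL.toLp h = 0 := by
    refine (ContinuousMap.toLp_denseRange ℂ haarTorus ℂ (p := 2)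
      (by simp)).eq_zero_of_inner_right ℂ ?_
    exact hall
  exact (Lp.eq_zero_iff_ae_eq_zero.1 hzero).symm.trans hL.coeFn_toLp |>.symm

lemma fourierCoefficient_sub {g h : Torus → ℂ} {A B : ℝ}
    (hg : AEStronglyMeasurable g haarTorus) (hgA : ∀ᵐ τ ∂haarTorus, ‖g τ‖ ≤ A)
    (hh : AEStronglyMeasurable h haarTorus) (hhB : ∀ᵐ τ ∂haarTorus, ‖h τ‖ ≤ B) (β : ℕ →₀ ℤ) :
    fourierCoefficient (g - h) β = fourierCoefficient g β - fourierCoefficient h β := by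
  have hc : Continuous fun τ => (starRingEnd ℂ) (torusMonomial β τ) :=
    (continuous_torusMonomial β).star
  rw [fourierCoefficient, fourierCoefficient, fourierCoefficient,
    ← integral_sub (integrable_mul_bounded hg hgA hc) (integrable_mul_bounded hh hhB hc)]
  congr 1 with τ
  rw [Pi.sub_apply, sub_mul]

lemma ae_eq_of_fourierCoefficient_eq {g h : Torus → ℂ} {A B : ℝ}
    (hg : AEStronglyMeasurable g haarTorus) (hgA : ∀ᵐ τ ∂haarTorus, ‖g τ‖ ≤ A)
    (hh : AEStronglyMeasurable h haarTorus) (hhB : ∀ᵐ τ ∂haarTorus, ‖h τ‖ ≤ B)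
    (heq : ∀ β, fourierCoefficient g β = fourierCoefficient h β) : g =ᵐ[haarTorus] h := by
  refine sub_ae_eq_zero _ _ |>.1 (ae_eq_zero_of_fourierCoefficient_eq_zero (M := A + B)
    (hg.sub hh) ?_ fun β => ?_)
  · filter_upwards [hgA, hhB] with τ h1 h2
    exact (norm_sub_le _ _).trans (add_le_add h1 h2)
  · rw [fourierCoefficient_sub hg hgA hh hhB, heq, sub_self]

lemma tendsto_fourierCoefficient {g : ℕ → Torus → ℂ} {h : Torus → ℂ}
    (hg : ∀ n, AEStronglyMeasurable (g n) haarTorus) (hM : ∀ n τ, ‖g n τ‖ ≤ M)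
    (hlim : ∀ᵐ τ ∂haarTorus, Tendsto (fun n => g n τ) atTop (𝓝 (h τ))) (β : ℕ →₀ ℤ) :
    Tendsto (fun n => fourierCoefficient (g n) β) atTop (𝓝 (fourierCoefficient h β)) := by
  refine tendsto_integral_of_dominated_convergence (fun _ => M)
    (fun n => (hg n).mul (continuous_torusMonomial β).star.aestronglyMeasurable)
    (integrable_const _) (fun n => Eventually.of_forall fun τ => ?_) ?_
  · rw [norm_mul, RCLike.norm_conj, norm_torusMonomial, mul_one]
    exact hM n τ
  · filter_upwards [hlim] with τ hτ
    exact hτ.mul_const _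

/-! ### Fourier coefficients of the contractions -/

lemma powerSeriesTerm_mul (f : Torus → ℂ) (n : ℕ) (a : ℕ → ℂ) (τ : Torus) (β : ℕ →₀ ℕ) :
    powerSeriesTerm f (truncate n fun j => a j * τ j) β =
      fourierCoefficient f (natIndex β) * truncatedMonomial n a β *
        torusMonomial (natIndex β) τ := by
  rw [powerSeriesTerm, mul_assoc, torusMonomial_eq_prod, truncatedMonomial]
  congr 1
  rw [natIndex, Finsupp.prod_mapRange_index (fun j => by simp), ← Finsupp.prod_mul]
  refine Finsupp.prod_congr fun j _ => ?_
  rw [zpow_natCast, Circle.coe_pow, ← mul_pow]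
  congr 1
  by_cases hj : j < n
  · rw [truncate_of_lt hj, truncate_of_lt hj]
  · rw [truncate_of_le (not_lt.1 hj), truncate_of_le (not_lt.1 hj), zero_mul]

lemma continuous_partialValue_mul (hM : ∀ᵐ τ ∂haarTorus, ‖f τ‖ ≤ M) {n : ℕ} {a : ℕ → ℂ}
    (ha : ∀ j < n, ‖a j‖ < 1) :
    Continuous fun τ : Torus => partialValue f n fun j => a j * τ j := by
  refine continuous_tsum (fun β => ?_) ((summable_norm_truncatedMonomial ha).mul_left M)
    fun β τ => norm_powerSeriesTerm_le hM (fun j _ => (norm_mul_circle _ _).le) β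
  simp only [powerSeriesTerm_mul]
  exact (continuous_torusMonomial _).const_mul _

lemma hasSum_fourierCoefficient_partialValue_mul (hf : IsAnalyticBounded f M) {n : ℕ} {a : ℕ → ℂ}
    (ha : ∀ j < n, ‖a j‖ < 1) (γ : ℕ →₀ ℤ) :
    HasSum (fun β => fourierCoefficient f (natIndex β) * truncatedMonomial n a β *
      if natIndex β = γ then 1 else 0)
      (fourierCoefficient (fun τ => partialValue f n fun j => a j * τ j) γ) := by
  have hz : ∀ τ : Torus, ∀ j < n, ‖a j * τ j‖ < 1 := fun τ j hj => by
    rw [norm_mul_circle]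
    exact ha j hj
  have h := hasSum_integral_of_dominated_convergence (μ := haarTorus)
    (F := fun β τ => powerSeriesTerm f (truncate n fun j => a j * τ j) β *
      (starRingEnd ℂ) (torusMonomial γ τ))
    (f := fun τ => (partialValue f n fun j => a j * τ j) * (starRingEnd ℂ) (torusMonomial γ τ))
    (fun β _ => M * ‖truncatedMonomial n a β‖)
    (fun β => by
      simp only [powerSeriesTerm_mul]
      exact (((continuous_torusMonomial _).const_mul _).mul
        (continuous_torusMonomial γ).star).aestronglyMeasurable)
    (fun β => Eventually.of_forall fun τ => by
      rw [norm_mul, RCLike.norm_conj, norm_torusMonomial, mul_one]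
      exact norm_powerSeriesTerm_le hf.norm_le (fun j _ => (norm_mul_circle _ _).le) β)
    (Eventually.of_forall fun τ => (summable_norm_truncatedMonomial ha).mul_left M)
    (integrable_const _)
    (Eventually.of_forall fun τ =>
      (hf.hasSum_powerSeriesTerm (hz τ)).summable.hasSum.mul_right _)
  refine h.congr_fun fun β => ?_
  rw [← fourierCoefficient_torusMonomial, fourierCoefficient.eq_def (torusMonomial _),
    ← integral_const_mul]
  congr 1 with τ
  rw [powerSeriesTerm_mul, mul_assoc _ (torusMonomial _ τ)]

lemma fourierCoefficient_partialValue_mul_natIndex (hf : IsAnalyticBounded f M) {n : ℕ}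
    {a : ℕ → ℂ} (ha : ∀ j < n, ‖a j‖ < 1) (β : ℕ →₀ ℕ) :
    fourierCoefficient (fun τ => partialValue f n fun j => a j * τ j) (natIndex β) =
      fourierCoefficient f (natIndex β) * truncatedMonomial n a β := by
  have h := hasSum_single (f := fun β' => fourierCoefficient f (natIndex β') *
    truncatedMonomial n a β' * if natIndex β' = natIndex β then 1 else 0) β
    fun β' hβ' => by simp [natIndex_injective.ne hβ']
  simpa using (hasSum_fourierCoefficient_partialValue_mul hf ha (natIndex β)).unique h

lemma fourierCoefficient_partialValue_mul_of_notMem (hf : IsAnalyticBounded f M) {n : ℕ}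
    {a : ℕ → ℂ} (ha : ∀ j < n, ‖a j‖ < 1) {γ : ℕ →₀ ℤ} (hγ : γ ∉ Set.range natIndex) :
    fourierCoefficient (fun τ => partialValue f n fun j => a j * τ j) γ = 0 := by
  refine (hasSum_fourierCoefficient_partialValue_mul hf ha γ).unique ?_
  refine hasSum_zero.congr_fun fun β => ?_
  rw [if_neg fun h => hγ ⟨β, h⟩, mul_zero]

/-- The contraction factors `p_j^{-θ}` of `b`. -/
def radius (θ : ℝ) (j : ℕ) : ℂ := (((prime j : ℝ) ^ (-θ) : ℝ) : ℂ)

lemma b_eq_mul (θ : ℝ) (τ : Torus) : b θ τ = fun j => radius θ j * τ j := rfl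

lemma norm_radius_lt_one {θ : ℝ} (hθ : 0 < θ) (j : ℕ) : ‖radius θ j‖ < 1 := by
  simpa [b_eq_mul] using (b_mem_polydiscC0 hθ 1).1 j

lemma IsAnalyticBounded.measurable_value_b (hf : IsAnalyticBounded f M) {θ : ℝ} (hθ : 0 < θ) :
    Measurable fun τ => value f (b θ τ) :=
  measurable_of_tendsto_metrizable
    (fun n => (continuous_partialValue_mul hf.norm_le (n := n)
      fun j _ => norm_radius_lt_one hθ j).measurable)
    (tendsto_pi_nhds.2 fun τ => hf.tendsto_partialValue (b_mem_polydiscC0 hθ τ))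

lemma IsAnalyticBounded.tendsto_fourierCoefficient_partialValue (hf : IsAnalyticBounded f M)
    {θ : ℝ} (hθ : 0 < θ) (γ : ℕ →₀ ℤ) :
    Tendsto (fun n => fourierCoefficient (fun τ => partialValue f n (b θ τ)) γ) atTop
      (𝓝 (fourierCoefficient (fun τ => value f (b θ τ)) γ)) :=
  tendsto_fourierCoefficient
    (fun n => (continuous_partialValue_mul hf.norm_le (n := n)
      fun j _ => norm_radius_lt_one hθ j).aestronglyMeasurable)
    (fun _ τ => hf.norm_partialValue_le fun j _ => (b_mem_polydiscC0 hθ τ).1 j)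
    (Eventually.of_forall fun τ => hf.tendsto_partialValue (b_mem_polydiscC0 hθ τ)) γ

lemma IsAnalyticBounded.fourierCoefficient_value_b_natIndex (hf : IsAnalyticBounded f M) {θ : ℝ}
    (hθ : 0 < θ) (β : ℕ →₀ ℕ) :
    fourierCoefficient (fun τ => value f (b θ τ)) (natIndex β) =
      fourierCoefficient f (natIndex β) * β.prod fun j k => radius θ j ^ k := by
  refine tendsto_nhds_unique (hf.tendsto_fourierCoefficient_partialValue hθ (natIndex β)) ?_
  refine tendsto_const_nhds.congr' ?_
  filter_upwards [eventually_gt_atTop (β.support.sup id)] with n hn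
  simp only [b_eq_mul]
  rw [fourierCoefficient_partialValue_mul_natIndex hf fun j _ => norm_radius_lt_one hθ j,
    truncatedMonomial]
  congr 1
  refine Finsupp.prod_congr fun j hj => ?_
  have hjn : j < n := (Finset.le_sup (f := id) hj).trans_lt hn
  rw [truncate_of_lt hjn]

lemma IsAnalyticBounded.fourierCoefficient_value_b_of_notMem (hf : IsAnalyticBounded f M) {θ : ℝ}
    (hθ : 0 < θ) {γ : ℕ →₀ ℤ} (hγ : γ ∉ Set.range natIndex) :
    fourierCoefficient (fun τ => value f (b θ τ)) γ = 0 := by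
  refine tendsto_nhds_unique (hf.tendsto_fourierCoefficient_partialValue hθ γ) ?_
  simp only [b_eq_mul]
  simp only [fourierCoefficient_partialValue_mul_of_notMem hf
    (fun j _ => norm_radius_lt_one hθ j) hγ, tendsto_const_nhds]

lemma IsAnalyticBounded.tendsto_fourierCoefficient_value_b (hf : IsAnalyticBounded f M)
    (γ : ℕ →₀ ℤ) :
    Tendsto (fun θ : ℝ => fourierCoefficient (fun τ => value f (b θ τ)) γ) (𝓝[>] 0)
      (𝓝 (fourierCoefficient f γ)) := by
  by_cases hγ : γ ∈ Set.range natIndex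
  · obtain ⟨β, rfl⟩ := hγ
    have h : Tendsto (fun θ => fourierCoefficient f (natIndex β) *
        β.prod fun j k => radius θ j ^ k) (𝓝 0) (𝓝 (fourierCoefficient f (natIndex β) *
        β.prod fun j k => radius 0 j ^ k)) := by
      refine Continuous.tendsto ?_ 0
      have : ∀ j, Continuous fun θ => radius θ j := fun j => by
        have hp : (0 : ℝ) < prime j := by exact_mod_cast (one_lt_prime j).le
        exact Complex.continuous_ofReal.comp
          (continuous_const.rpow continuous_neg fun _ => Or.inl hp.ne')
      unfold Finsupp.prod
      fun_prop
    have h1 : (β.prod fun j k => radius 0 j ^ k) = 1 := by simp [radius, Finsupp.prod]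
    rw [h1, mul_one] at h
    refine (h.mono_left nhdsWithin_le_nhds).congr' ?_
    filter_upwards [self_mem_nhdsWithin] with θ hθ
    exact (hf.fourierCoefficient_value_b_natIndex hθ β).symm
  · rw [hf.analytic γ (exists_neg_of_notMem_range_natIndex hγ)]
    refine tendsto_const_nhds.congr' ?_
    filter_upwards [self_mem_nhdsWithin] with θ hθ
    exact (hf.fourierCoefficient_value_b_of_notMem hθ hγ).symm

/-! ### The boundary function -/

/-- By continuity, a limit along the positive rationals is a limit along the positive reals. This
makes the set of convergence accessible to countable operations. -/
lemma tendsto_of_tendsto_rat {φ : ℝ → ℂ} (hφ : ContinuousOn φ (Set.Ioi 0)) {c : ℂ}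
    (h : Tendsto (fun q : {q : ℚ // 0 < q} => φ (q : ℚ))
      (comap (fun q : {q : ℚ // 0 < q} => ((q : ℚ) : ℝ)) (𝓝[>] 0)) (𝓝 c)) :
    Tendsto φ (𝓝[>] 0) (𝓝 c) := by
  rw [Metric.tendsto_nhds] at h ⊢
  intro ε hε
  obtain ⟨s, hs, hsub⟩ := mem_comap.1 (h (ε / 2) (half_pos hε))
  obtain ⟨δ, hδ, hδs⟩ := mem_nhdsGT_iff_exists_Ioo_subset.1 hs
  filter_upwards [Ioo_mem_nhdsGT hδ] with θ hθ
  by_contra! hcon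
  have hcont : ContinuousAt φ θ := hφ.continuousAt (Ioi_mem_nhds hθ.1)
  have hev : ∀ᶠ x in 𝓝 θ, ε / 2 < dist (φ x) c ∧ x ∈ Set.Ioo 0 δ :=
    ((hcont.dist continuousAt_const).eventually (lt_mem_nhds (by linarith))).and
      (Ioo_mem_nhds hθ.1 hθ.2)
  obtain ⟨q, hq1, hq2⟩ := Rat.denseRange_cast.mem_nhds hev
  have hq0 : 0 < q := by exact_mod_cast hq2.1
  have hlt : dist (φ q) c < ε / 2 := hsub (show ((⟨q, hq0⟩ : {q : ℚ // 0 < q}) : ℚ) ∈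
    (fun q : ℚ => (q : ℝ)) ⁻¹' s from hδs hq2)
  exact hq1.not_gt hlt

/-- The set of the points of the torus at which `f` has a limit along `θ ↦ b θ τ`. -/
def convergenceSet (f : Torus → ℂ) : Set Torus :=
  {τ | ∃ c, Tendsto (fun θ : ℝ => value f (b θ τ)) (𝓝[>] 0) (𝓝 c)}

lemma IsAnalyticBounded.measurableSet_convergenceSet (hf : IsAnalyticBounded f M) :
    MeasurableSet (convergenceSet f) := by
  have h := measurableSet_exists_tendsto
    (l := comap (fun q : {q : ℚ // 0 < q} => ((q : ℚ) : ℝ)) (𝓝[>] 0))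
    (f := fun q τ => value f (b (q : ℚ) τ))
    fun q => hf.measurable_value_b (by exact_mod_cast q.2)
  convert h using 1
  ext τ
  exact ⟨fun ⟨c, hc⟩ => ⟨c, hc.comp tendsto_comap⟩,
    fun ⟨c, hc⟩ => ⟨c, tendsto_of_tendsto_rat (hf.continuousOn_value_b τ) hc⟩⟩

lemma continuous_flow : Continuous fun x : ℝ × Torus => flow x.1 x.2 := by
  unfold flow
  fun_prop

lemma measurePreserving_flow (t : ℝ) : MeasurePreserving (flow t) haarTorus haarTorus :=
  measurePreserving_mul_left haarTorus fun j => Circle.exp (-(t * Real.log (prime j)))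

/-- A measurable set that contains almost every point of every orbit of the flow has full measure,
by Fubini's theorem and the invariance of the Haar measure. -/
lemma ae_of_forall_ae_flow {E : Set Torus} (hE : MeasurableSet E)
    (h : ∀ τ, ∀ᵐ t : ℝ, flow t τ ∈ E) : ∀ᵐ τ ∂haarTorus, τ ∈ E := by
  have hcomm : ∀ᵐ t : ℝ, ∀ᵐ τ ∂haarTorus, flow t τ ∈ E :=
    (Measure.ae_ae_comm (p := fun (t : ℝ) τ => flow t τ ∈ E)
      (continuous_flow.measurable hE)).2 (Eventually.of_forall h)
  obtain ⟨t, ht⟩ := hcomm.exists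
  rw [← (measurePreserving_flow t).map_eq]
  exact (ae_map_iff (measurePreserving_flow t).measurable.aemeasurable hE).2 ht

/-- The boundary function obtained from the limits along `θ ↦ b θ τ`, and `0` where there is no
limit. -/
def boundaryFunction (f : Torus → ℂ) : Torus → ℂ :=
  (convergenceSet f).indicator fun τ => limUnder (𝓝[>] 0) fun θ : ℝ => value f (b θ τ)

lemma tendsto_boundaryFunction {τ : Torus} (hτ : τ ∈ convergenceSet f) :
    Tendsto (fun θ : ℝ => value f (b θ τ)) (𝓝[>] 0) (𝓝 (boundaryFunction f τ)) := by
  rw [boundaryFunction, Set.indicator_of_mem hτ]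
  exact tendsto_nhds_limUnder hτ

lemma tendsto_one_div_add_one : Tendsto (fun k : ℕ => 1 / ((k : ℝ) + 1)) atTop (𝓝[>] 0) :=
  tendsto_nhdsWithin_iff.2 ⟨tendsto_one_div_add_atTop_nhds_zero_nat,
    Eventually.of_forall fun k => by simp only [Set.mem_Ioi]; positivity⟩

lemma IsAnalyticBounded.measurable_boundaryFunction (hf : IsAnalyticBounded f M) :
    Measurable (boundaryFunction f) := by
  refine measurable_of_tendsto_metrizable (f := fun (k : ℕ) => (convergenceSet f).indicator
    fun τ => value f (b (1 / ((k : ℝ) + 1)) τ)) (fun k => ?_) (tendsto_pi_nhds.2 fun τ => ?_)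
  · exact (hf.measurable_value_b (by positivity)).indicator hf.measurableSet_convergenceSet
  · by_cases hτ : τ ∈ convergenceSet f
    · simp only [Set.indicator_of_mem hτ]
      exact (tendsto_boundaryFunction hτ).comp tendsto_one_div_add_one
    · simp only [boundaryFunction, Set.indicator_of_notMem hτ, tendsto_const_nhds]

lemma IsAnalyticBounded.ae_mem_convergenceSet (hf : IsAnalyticBounded f M) :
    ∀ᵐ τ ∂haarTorus, τ ∈ convergenceSet f :=
  ae_of_forall_ae_flow hf.measurableSet_convergenceSet hf.ae_exists_tendsto_flow

lemma IsAnalyticBounded.boundaryFunction_ae_eq (hf : IsAnalyticBounded f M) :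
    boundaryFunction f =ᵐ[haarTorus] f := by
  have hbound : ∀ᵐ τ ∂haarTorus, ‖boundaryFunction f τ‖ ≤ M := by
    filter_upwards [hf.ae_mem_convergenceSet] with τ hτ
    refine le_of_tendsto (tendsto_boundaryFunction hτ).norm ?_
    filter_upwards [self_mem_nhdsWithin] with θ hθ
    exact hf.norm_value_le (b_mem_polydiscC0 hθ τ)
  refine ae_eq_of_fourierCoefficient_eq hf.measurable_boundaryFunction.aestronglyMeasurable hbound
    hf.aestronglyMeasurable hf.norm_le fun γ => ?_
  refine tendsto_nhds_unique (tendsto_fourierCoefficient (M := M)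
    (g := fun (k : ℕ) τ => value f (b (1 / ((k : ℝ) + 1)) τ)) (fun k => ?_) (fun k τ => ?_) ?_ γ)
    ((hf.tendsto_fourierCoefficient_value_b γ).comp tendsto_one_div_add_one)
  · exact (hf.measurable_value_b (by positivity)).aestronglyMeasurable
  · exact hf.norm_value_le (b_mem_polydiscC0 (by positivity) τ)
  · filter_upwards [hf.ae_mem_convergenceSet] with τ hτ
    exact (tendsto_boundaryFunction hτ).comp tendsto_one_div_add_one

lemma isAnalyticBounded_of_mem_HInfty {F : Lp ℂ ⊤ haarTorus} (hF : F ∈ HInfty) :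
    IsAnalyticBounded F ‖F‖ where
  aestronglyMeasurable := Lp.aestronglyMeasurable F
  norm_le := by
    have h := ae_le_eLpNormEssSup (f := F) (μ := haarTorus)
    filter_upwards [h] with τ hτ
    rw [← eLpNorm_exponent_top] at hτ
    rw [Lp.norm_def, ← toReal_enorm]
    exact ENNReal.toReal_mono (Lp.eLpNorm_ne_top F) hτ
  analytic := hF

end InfPolydisc

end

/-- For `F` in `H^∞(𝔻^∞)`: the values of `F` on `𝔻^∞ ∩ c₀` are well defined, and the boundary
function of `F` has a Borel representative `Ft` with `Ft(τ) = lim_{θ → 0+} F(b_θ(τ))` for almost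
every `τ ∈ 𝕋^∞` and, for every `τ ∈ 𝕋^∞`, at almost every point of the orbit of `τ` under the
Kronecker flow, with respect to Lebesgue measure on the `t`-line. -/
theorem theorem9 (F : Lp ℂ ⊤ haarTorus) (hF : F ∈ HInfty) :
    (∀ z ∈ polydiscC0, HasValue F z (value F z)) ∧
    ∃ Ft : Torus → ℂ, Measurable Ft ∧ Ft =ᵐ[haarTorus] F ∧
      (∀ᵐ τ ∂haarTorus, Tendsto (fun θ : ℝ => value F (b θ τ)) (𝓝[>] 0) (𝓝 (Ft τ))) ∧
      ∀ τ : Torus, ∀ᵐ t : ℝ,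
        Tendsto (fun θ : ℝ => value F (b θ (flow t τ))) (𝓝[>] 0) (𝓝 (Ft (flow t τ))) := by
  have hf := isAnalyticBounded_of_mem_HInfty hF
  refine ⟨fun z hz => hf.hasValue hz, boundaryFunction F, hf.measurable_boundaryFunction,
    hf.boundaryFunction_ae_eq, ?_, fun τ => ?_⟩
  · filter_upwards [hf.ae_mem_convergenceSet] with τ hτ using tendsto_boundaryFunction hτ
  · filter_upwards [hf.ae_exists_tendsto_flow τ] with t ht using tendsto_boundaryFunction ht
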